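/- Let $n,m\ge 0$ be integers and $q=\max(n,m)$. In the symmetric deterministic interference channel, the transmitters send in each time slot $i$ vectors $X_{1i},X_{2i}\in\mathbb F_2^q$ (most significant bit first), and the receivers observe $$Y_{1i}=S^{q-n}X_{1i}\oplus S^{q-m}X_{2i},\qquad Y_{2i}=S^{q-m}X_{1i}\oplus S^{q-n}X_{2i},$$ where $S^{q-a}$ is the $q\times q$ matrix over $\mathbb F_2$ whose non-zero entries are those at the positions $(q-a+k,k)$, $1\le k\le a$. The messages $W_k\in\{1,\dots,M_k\}$, $k=1,2$, are independent and uniformly distributed. With four feedback links, where each receiver feeds its output back to both transmitters, a code of block length $N$ consists of encoding functions $X_{ki}=f_k^i(W_k,Y_1^{i-1},Y_2^{i-1})$, $k=1,2$, $1\le i\le N$, and of decoding functions $\hat W_k=g_k(Y_k^N)$. A pair $(R_1,R_2)$ of non-negative reals is achievable if there is a sequence of such codes, one for each block length $N$, with $M_k\ge 2^{NR_k}$ for $k=1,2$ and all large $N$, and $\Pr[(\hat W_1,\hat W_2)\ne(W_1,W_2)]\to 0$ as $N\to\infty$. Let $\mathcal R$ be the closure of the set of achievable pairs, and let $C_{\mathrm{sum}}=\sup\{R_1+R_2:(R_1,R_2)\in\mathcal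 R\}$. Then $$C_{\mathrm{sum}}=\max(n,m)+(n-m)^+ ,\qquad\text{where } (x)^+=\max(x,0).$$ -/

import Mathlib

namespace FeedbackIC

open Filter Topology

/-- A channel vector: `q` bit levels over the two-element field (addition is XOR). Index `0` is
the most significant bit and index `q - 1` the least significant one. -/
abbrev Signal (q : ℕ) : Type := Fin q → ZMod 2

/-- The `q × q` shift matrix `S ^ (q - a)`: its non-zero entries are at the positions
`(q - a + k, k)`. For `a ≤ q` it moves the `a` most significant bits to the `a` lowest levels
and drops the other bits. -/
def shiftMatrix (q a : ℕ) : Matrix (Fin q) (Fin q) (ZMod 2) :=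
  Matrix.of fun r c => if (r : ℕ) = q - a + (c : ℕ) then 1 else 0

/-- The received signal at a receiver of the symmetric deterministic interference channel with
`n` levels on direct links and `m` levels on cross links, when its own transmitter sends `x`
and the other transmitter sends `x'`. The number of levels is `q = max n m`. -/
def received (n m : ℕ) (x x' : Signal (max n m)) : Signal (max n m) :=
  (shiftMatrix (max n m) n).mulVec x + (shiftMatrix (max n m) m).mulVec x'

/-- A code of block length `N` with `M₁`, `M₂` messages for the channel with four feedback links.
The input of transmitter `k` in a time slot `i` (slots are numbered from `0`) is
`encₖ i w y₁ y₂`, where `w` is its own message and `y₁`, `y₂` are the outputs of receivers 1 and 2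
in the `i` earlier slots. Only the encoding functions of slots `i < N` are used.
Receiver `k` decodes from its own `N` outputs. -/
structure Code (n m N M₁ M₂ : ℕ) where
  enc₁ : (i : ℕ) → Fin M₁ → (Fin i → Signal (max n m)) → (Fin i → Signal (max n m)) →
    Signal (max n m)
  enc₂ : (i : ℕ) → Fin M₂ → (Fin i → Signal (max n m)) → (Fin i → Signal (max n m)) →
    Signal (max n m)
  dec₁ : (Fin N → Signal (max n m)) → Fin M₁
  dec₂ : (Fin N → Signal (max n m)) → Fin M₂

namespace Code

variable {n m N M₁ M₂ : ℕ}

/-- The pairs (output of receiver 1, output of receiver 2) in the first `i` time slots when the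
messages are `w₁` and `w₂`. -/
def outputs (c : Code n m N M₁ M₂) (w₁ : Fin M₁) (w₂ : Fin M₂) :
    (i : ℕ) → Fin i → Signal (max n m) × Signal (max n m)
  | 0 => Fin.elim0
  | i + 1 =>
    let past := c.outputs w₁ w₂ i
    let x₁ := c.enc₁ i w₁ (fun j => (past j).1) (fun j => (past j).2)
    let x₂ := c.enc₂ i w₂ (fun j => (past j).1) (fun j => (past j).2)
    Fin.snoc (α := fun _ => Signal (max n m) × Signal (max n m)) past
      (received n m x₁ x₂, received n m x₂ x₁)

/-- Both receivers decode the message intended for them when the messages are `w₁` and `w₂`. -/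
def Correct (c : Code n m N M₁ M₂) (w₁ : Fin M₁) (w₂ : Fin M₂) : Prop :=
  c.dec₁ (fun j => (c.outputs w₁ w₂ N j).1) = w₁ ∧
  c.dec₂ (fun j => (c.outputs w₁ w₂ N j).2) = w₂

/-- The probability that at least one of the two messages is decoded wrongly, when the messages
are independent and uniformly distributed, that is, when the message pair is uniform on
`Fin M₁ × Fin M₂`. -/
noncomputable def errorProb (c : Code n m N M₁ M₂) : ℝ :=
  (Nat.card {w : Fin M₁ × Fin M₂ // ¬ c.Correct w.1 w.2} : ℝ) / ((M₁ : ℝ) * (M₂ : ℝ))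

end Code

/-- A pair of non-negative rates (in bits per channel use) is achievable if there is a sequence
of codes, one for each block length `N`, with at least `2 ^ (N R₁)` and `2 ^ (N R₂)` messages for
all large `N`, whose error probabilities tend to zero. -/
def Achievable (n m : ℕ) (R : ℝ × ℝ) : Prop :=
  0 ≤ R.1 ∧ 0 ≤ R.2 ∧
  ∃ (M₁ M₂ : ℕ → ℕ) (c : (N : ℕ) → Code n m N (M₁ N) (M₂ N)),
    (∀ᶠ N : ℕ in atTop, (2 : ℝ) ^ ((N : ℝ) * R.1) ≤ (M₁ N : ℝ) ∧
      (2 : ℝ) ^ ((N : ℝ) * R.2) ≤ (M₂ N : ℝ)) ∧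
    Tendsto (fun N => (c N).errorProb) atTop (𝓝 0)

/-- The capacity region: the closure of the set of achievable rate pairs. -/
def capacityRegion (n m : ℕ) : Set (ℝ × ℝ) :=
  closure {R | Achievable n m R}

/-- `C` is the sum capacity: the supremum of `R₁ + R₂` over the capacity region (in particular
this supremum is finite). -/
def IsSumCapacity (n m : ℕ) (C : ℝ) : Prop :=
  IsLUB ((fun R : ℝ × ℝ => R.1 + R.2) '' capacityRegion n m) C

end FeedbackIC

namespace FeedbackIC

open Filter Topology

/-! Write `q = max n m`; the sum capacity is `q + (q - m)`. Upper bound: a counting argument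
replaces entropy. On correctly decoded message pairs, the output of receiver 1 together with the `q
- m` lowest levels of transmitter 2, unheard there, determines both messages (`card_correct_le`). So
only `2 ^ (N * (q + (q - m)))` pairs can be decoded. Lower bound for `n ≠ m`: in the first of two
slots both users send `q` bits; in the second each relays the `m` interfering bits, learned through
feedback, above `q - m` fresh bits. Each receiver can then separate its own bits
(`two_slot_injective`), so `2 * (q + (q - m))` bits pass in two slots. For `n = m` one user alone
suffices. -/

theorem shiftMatrix_mulVec_apply (q a : ℕ) (x : Signal q) (r : Fin q) :
    (shiftMatrix q a).mulVec x r =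
      if q - a ≤ (r : ℕ) then x ⟨(r : ℕ) - (q - a), by omega⟩ else 0 := by
  simp only [Matrix.mulVec, dotProduct, shiftMatrix, Matrix.of_apply, ite_mul, one_mul, zero_mul]
  split_ifs with h
  · rw [Finset.sum_eq_single ⟨(r : ℕ) - (q - a), by omega⟩]
    · rw [if_pos]
      simp only
      omega
    · intro b _ hb
      rw [if_neg]
      intro h'
      apply hb
      ext
      simp only
      omega
    · simp
  · apply Finset.sum_eq_zero
    intro b _
    rw [if_neg]
    omega

theorem received_apply (n m : ℕ) (x x' : Signal (max n m)) (r : Fin (max n m)) :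
    received n m x x' r =
      (if max n m - n ≤ (r : ℕ) then x ⟨(r : ℕ) - (max n m - n), by omega⟩ else 0) +
      (if max n m - m ≤ (r : ℕ) then x' ⟨(r : ℕ) - (max n m - m), by omega⟩ else 0) := by
  simp only [received, Pi.add_apply, shiftMatrix_mulVec_apply]

/-! ### Converse: counting correctly decoded message pairs -/

namespace Code

variable {n m N M₁ M₂ : ℕ}

/-- The input of transmitter 1 in time slot `i`. -/
def input₁ (c : Code n m N M₁ M₂) (w₁ : Fin M₁) (w₂ : Fin M₂) (i : ℕ) : Signal (max n m) :=
  c.enc₁ i w₁ (fun j => (c.outputs w₁ w₂ i j).1) (fun j => (c.outputs w₁ w₂ i j).2)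

/-- The input of transmitter 2 in time slot `i`. -/
def input₂ (c : Code n m N M₁ M₂) (w₁ : Fin M₁) (w₂ : Fin M₂) (i : ℕ) : Signal (max n m) :=
  c.enc₂ i w₂ (fun j => (c.outputs w₁ w₂ i j).1) (fun j => (c.outputs w₁ w₂ i j).2)

theorem outputs_apply (c : Code n m N M₁ M₂) (w₁ : Fin M₁) (w₂ : Fin M₂) (i : ℕ) (j : Fin i) :
    c.outputs w₁ w₂ i j =
      (received n m (c.input₁ w₁ w₂ j) (c.input₂ w₁ w₂ j),
        received n m (c.input₂ w₁ w₂ j) (c.input₁ w₁ w₂ j)) := by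
  induction i with
  | zero => exact j.elim0
  | succ i ih =>
    refine Fin.lastCases ?_ (fun j => ?_) j
    · simp only [outputs, Fin.snoc_last, Fin.val_last]
      rfl
    · simp only [outputs, Fin.snoc_castSucc, Fin.val_castSucc]
      exact ih j

/-- Message 1, the outputs of receiver 1 and the levels of the inputs of transmitter 2 that
receiver 1 does not hear determine all outputs. -/
theorem outputs_eq_of_side_information (c : Code n m N M₁ M₂) {w₁ : Fin M₁} {w₂ w₂' : Fin M₂}
    (i : ℕ)
    (hY : ∀ j < i, received n m (c.input₁ w₁ w₂ j) (c.input₂ w₁ w₂ j) =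
      received n m (c.input₁ w₁ w₂' j) (c.input₂ w₁ w₂' j))
    (hX : ∀ j < i, ∀ r : Fin (max n m), m ≤ (r : ℕ) →
      c.input₂ w₁ w₂ j r = c.input₂ w₁ w₂' j r) :
    c.outputs w₁ w₂ i = c.outputs w₁ w₂' i := by
  induction i with
  | zero => exact Subsingleton.elim _ _
  | succ i ih =>
    have hpast := ih (fun j hj => hY j (by omega)) (fun j hj => hX j (by omega))
    have h₁ : c.input₁ w₁ w₂ i = c.input₁ w₁ w₂' i := by simp only [input₁, hpast]
    have h₂ : c.input₂ w₁ w₂ i = c.input₂ w₁ w₂' i := by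
      funext r
      by_cases hr : m ≤ (r : ℕ)
      · exact hX i (by omega) r hr
      -- Level `r < m` of input 2 reaches receiver 1 at level `r + (q - m)`; the contribution of
      -- input 1 is already known and cancels.
      · have h := congrFun (hY i (by omega)) ⟨r + (max n m - m), by omega⟩
        simpa only [received_apply, h₁, add_right_inj, le_add_iff_nonneg_left, zero_le, if_true,
          Nat.add_sub_cancel] using h
    funext j
    refine Fin.lastCases ?_ (fun j => ?_) j
    · simp only [outputs_apply, Fin.val_last, h₁, h₂]
    · have h := congrFun hpast j
      simpa only [outputs_apply, Fin.val_castSucc] using h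

theorem card_correct_le (c : Code n m N M₁ M₂) :
    Nat.card {w : Fin M₁ × Fin M₂ // c.Correct w.1 w.2} ≤
      2 ^ (N * (max n m + (max n m - m))) := by
  let F : {w : Fin M₁ × Fin M₂ // c.Correct w.1 w.2} →
      (Fin N → Signal (max n m)) × (Fin N → Fin (max n m - m) → ZMod 2) := fun w =>
    (fun j => (c.outputs w.1.1 w.1.2 N j).1,
      fun j k => c.input₂ w.1.1 w.1.2 j ⟨m + k, by omega⟩)
  have hF : Function.Injective F := by
    rintro ⟨⟨w₁, w₂⟩, hc⟩ ⟨⟨w₁', w₂'⟩, hc'⟩ h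
    obtain ⟨hY, hX⟩ := Prod.mk.inj h
    simp only at hY hX
    obtain rfl : w₁ = w₁' := hc.1.symm.trans ((congrArg c.dec₁ hY).trans hc'.1)
    have hout : c.outputs w₁ w₂ N = c.outputs w₁ w₂' N := by
      apply outputs_eq_of_side_information
      · intro j hj
        simpa only [outputs_apply] using congrFun hY ⟨j, hj⟩
      · intro j hj r hr
        have h := congrFun (congrFun hX ⟨j, hj⟩) ⟨r - m, by omega⟩
        simpa only [Nat.add_sub_cancel' hr] using h
    obtain rfl : w₂ = w₂' :=
      hc.2.symm.trans ((congrArg (fun o => c.dec₂ fun j => (o j).2) hout).trans hc'.2)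
    rfl
  refine (Nat.card_le_card_of_injective F hF).trans (le_of_eq ?_)
  simp only [Nat.card_eq_fintype_card, Fintype.card_prod, Fintype.card_pi, ZMod.card,
    Finset.prod_const, Finset.card_univ, Fintype.card_fin]
  rw [← pow_mul, ← pow_mul, ← pow_add]
  ring_nf

theorem one_sub_errorProb_mul_le (c : Code n m N M₁ M₂) :
    (1 - c.errorProb) * ((M₁ : ℝ) * M₂) ≤ 2 ^ (N * (max n m + (max n m - m))) := by
  classical
  rcases eq_or_ne ((M₁ : ℝ) * M₂) 0 with h0 | h0
  · rw [h0, mul_zero]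
    positivity
  have hsplit : Nat.card {w : Fin M₁ × Fin M₂ // c.Correct w.1 w.2} +
      Nat.card {w : Fin M₁ × Fin M₂ // ¬ c.Correct w.1 w.2} = M₁ * M₂ := by
    have h := Fintype.card_subtype_compl (fun w : Fin M₁ × Fin M₂ => c.Correct w.1 w.2)
    have h' := Fintype.card_subtype_le (fun w : Fin M₁ × Fin M₂ => c.Correct w.1 w.2)
    rw [Nat.card_eq_fintype_card, Nat.card_eq_fintype_card, h, Nat.add_sub_cancel' h']
    simp
  have hsplit' : (Nat.card {w : Fin M₁ × Fin M₂ // c.Correct w.1 w.2} : ℝ) +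
      Nat.card {w : Fin M₁ × Fin M₂ // ¬ c.Correct w.1 w.2} = (M₁ : ℝ) * M₂ := by
    exact_mod_cast hsplit
  have hle : (Nat.card {w : Fin M₁ × Fin M₂ // c.Correct w.1 w.2} : ℝ) ≤
      2 ^ (N * (max n m + (max n m - m))) := by
    exact_mod_cast c.card_correct_le
  have : (1 - c.errorProb) * ((M₁ : ℝ) * M₂) =
      Nat.card {w : Fin M₁ × Fin M₂ // c.Correct w.1 w.2} := by
    rw [errorProb, sub_mul, div_mul_cancel₀ _ h0]
    linarith
  rw [this]
  exact hle

end Code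

theorem Achievable.add_le {n m : ℕ} {R : ℝ × ℝ} (hR : Achievable n m R) :
    R.1 + R.2 ≤ ((max n m + (max n m - m) : ℕ) : ℝ) := by
  obtain ⟨-, -, M₁, M₂, c, hM, herr⟩ := hR
  set C : ℕ := max n m + (max n m - m)
  by_contra! hlt
  have hhalf : ∀ᶠ N in atTop, (c N).errorProb < 1 / 2 :=
    herr.eventually (gt_mem_nhds (by norm_num))
  have hlarge : ∀ᶠ N : ℕ in atTop, 1 < (N : ℝ) * (R.1 + R.2 - C) :=
    (tendsto_natCast_atTop_atTop.atTop_mul_const (sub_pos.mpr hlt)).eventually_gt_atTop 1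
  obtain ⟨N, ⟨h₁, h₂⟩, h₃, h₄⟩ := (hM.and (hhalf.and hlarge)).exists
  have hprod : (2 : ℝ) ^ ((N : ℝ) * (R.1 + R.2)) ≤ (M₁ N : ℝ) * M₂ N := by
    rw [mul_add, Real.rpow_add two_pos]
    exact mul_le_mul h₁ h₂ (by positivity) (by positivity)
  have hcode := (c N).one_sub_errorProb_mul_le
  -- Error probability below `1 / 2` costs at most a factor `2`, hence the extra bit in the
  -- exponent, which `hlarge` excludes.
  have hbound : (2 : ℝ) ^ ((N : ℝ) * (R.1 + R.2)) ≤ (2 : ℝ) ^ (1 + (N : ℝ) * C) := by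
    have hpow : (2 : ℝ) ^ (1 + (N : ℝ) * C) = 2 * 2 ^ (N * C) := by
      rw [Real.rpow_add two_pos, Real.rpow_one, ← Nat.cast_mul, Real.rpow_natCast]
    have hpos : 0 ≤ (M₁ N : ℝ) * M₂ N := by positivity
    rw [hpow]
    nlinarith
  have := (Real.rpow_le_rpow_left_iff one_lt_two).mp hbound
  linarith

/-! ### Achievability: repeating a two-slot scheme -/

/-- The input of a transmitter that repeats a two-slot encoder, sending block `k` of its message
in the time slots `2 * k` and `2 * k + 1`. -/
def blockInput {q : ℕ} {A : Type*} (f : A → Signal q) (g : A → Signal q → Signal q → Signal q)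
    (a : ℕ → A) (i : ℕ) (y₁ y₂ : Fin i → Signal q) : Signal q :=
  if h : i % 2 = 0 then f (a (i / 2))
  else g (a (i / 2)) (y₁ ⟨i - 1, by omega⟩) (y₂ ⟨i - 1, by omega⟩)

theorem blockInput_even {q : ℕ} {A : Type*} (f : A → Signal q)
    (g : A → Signal q → Signal q → Signal q) (a : ℕ → A) (k : ℕ)
    (y₁ y₂ : Fin (2 * k) → Signal q) : blockInput f g a (2 * k) y₁ y₂ = f (a k) := by
  simp [blockInput]

theorem blockInput_odd {q : ℕ} {A : Type*} (f : A → Signal q)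
    (g : A → Signal q → Signal q → Signal q) (a : ℕ → A) (k : ℕ)
    (y₁ y₂ : Fin (2 * k + 1) → Signal q) :
    blockInput f g a (2 * k + 1) y₁ y₂ = g (a k) (y₁ (Fin.last _)) (y₂ (Fin.last _)) := by
  have h : (2 * k + 1) / 2 = k := by omega
  rw [blockInput, dif_neg (by omega), h]
  rfl

/-- Repeating a two-slot scheme that conveys `s₁` and `s₂` bits without error achieves every
rate pair below `(s₁ / 2, s₂ / 2)` on the ray through it. -/
theorem achievable_of_two_slot_scheme {n m : ℕ} {A₁ A₂ : Type} [Fintype A₁] [Fintype A₂]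
    [Inhabited A₁] [Inhabited A₂]
    (f₁ : A₁ → Signal (max n m)) (f₂ : A₂ → Signal (max n m))
    (g₁ : A₁ → Signal (max n m) → Signal (max n m) → Signal (max n m))
    (g₂ : A₂ → Signal (max n m) → Signal (max n m) → Signal (max n m))
    (d₁ : Signal (max n m) → Signal (max n m) → A₁)
    (d₂ : Signal (max n m) → Signal (max n m) → A₂)
    (hd₁ : ∀ a b, d₁ (received n m (f₁ a) (f₂ b))
      (received n m (g₁ a (received n m (f₁ a) (f₂ b)) (received n m (f₂ b) (f₁ a)))
        (g₂ b (received n m (f₁ a) (f₂ b)) (received n m (f₂ b) (f₁ a)))) = a)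
    (hd₂ : ∀ a b, d₂ (received n m (f₂ b) (f₁ a))
      (received n m (g₂ b (received n m (f₁ a) (f₂ b)) (received n m (f₂ b) (f₁ a)))
        (g₁ a (received n m (f₁ a) (f₂ b)) (received n m (f₂ b) (f₁ a)))) = b)
    {s₁ s₂ : ℕ} (hs₁ : Fintype.card A₁ = 2 ^ s₁) (hs₂ : Fintype.card A₂ = 2 ^ s₂)
    {t : ℝ} (ht₀ : 0 ≤ t) (ht₁ : t < 1) :
    Achievable n m (t * (s₁ / 2), t * (s₂ / 2)) := by
  classical
  let e₁ : (N : ℕ) → Fin (Fintype.card (Fin (N / 2) → A₁)) ≃ (Fin (N / 2) → A₁) :=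
    fun N => (Fintype.equivFin _).symm
  let e₂ : (N : ℕ) → Fin (Fintype.card (Fin (N / 2) → A₂)) ≃ (Fin (N / 2) → A₂) :=
    fun N => (Fintype.equivFin _).symm
  -- For odd `N` the last slot belongs to an incomplete block; it carries `default` and is ignored
  -- by the decoders.
  let u₁ : (N : ℕ) → Fin (Fintype.card (Fin (N / 2) → A₁)) → ℕ → A₁ := fun N w k =>
    if h : k < N / 2 then e₁ N w ⟨k, h⟩ else default
  let u₂ : (N : ℕ) → Fin (Fintype.card (Fin (N / 2) → A₂)) → ℕ → A₂ := fun N w k =>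
    if h : k < N / 2 then e₂ N w ⟨k, h⟩ else default
  let c : (N : ℕ) → Code n m N (Fintype.card (Fin (N / 2) → A₁))
      (Fintype.card (Fin (N / 2) → A₂)) := fun N =>
    { enc₁ := fun i w => blockInput f₁ g₁ (u₁ N w) i
      enc₂ := fun i w => blockInput f₂ g₂ (u₂ N w) i
      dec₁ := fun y => (e₁ N).symm fun k =>
        d₁ (y ⟨2 * k, by omega⟩) (y ⟨2 * k + 1, by omega⟩)
      dec₂ := fun y => (e₂ N).symm fun k =>
        d₂ (y ⟨2 * k, by omega⟩) (y ⟨2 * k + 1, by omega⟩) }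
  have hcorrect : ∀ N w₁ w₂, (c N).Correct w₁ w₂ := by
    intro N w₁ w₂
    have hin₁ : ∀ i, (c N).input₁ w₁ w₂ i = blockInput f₁ g₁ (u₁ N w₁) i
        (fun j => ((c N).outputs w₁ w₂ i j).1) (fun j => ((c N).outputs w₁ w₂ i j).2) :=
      fun _ => rfl
    have hin₂ : ∀ i, (c N).input₂ w₁ w₂ i = blockInput f₂ g₂ (u₂ N w₂) i
        (fun j => ((c N).outputs w₁ w₂ i j).1) (fun j => ((c N).outputs w₁ w₂ i j).2) :=
      fun _ => rfl
    have heven₁ : ∀ k, (c N).input₁ w₁ w₂ (2 * k) = f₁ (u₁ N w₁ k) :=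
      fun k => (hin₁ _).trans (blockInput_even ..)
    have heven₂ : ∀ k, (c N).input₂ w₁ w₂ (2 * k) = f₂ (u₂ N w₂ k) :=
      fun k => (hin₂ _).trans (blockInput_even ..)
    have hodd₁ : ∀ k, (c N).input₁ w₁ w₂ (2 * k + 1) = g₁ (u₁ N w₁ k)
        (received n m (f₁ (u₁ N w₁ k)) (f₂ (u₂ N w₂ k)))
        (received n m (f₂ (u₂ N w₂ k)) (f₁ (u₁ N w₁ k))) := by
      intro k
      rw [hin₁, blockInput_odd]
      simp only [Code.outputs_apply, Fin.val_last, heven₁, heven₂]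
    have hodd₂ : ∀ k, (c N).input₂ w₁ w₂ (2 * k + 1) = g₂ (u₂ N w₂ k)
        (received n m (f₁ (u₁ N w₁ k)) (f₂ (u₂ N w₂ k)))
        (received n m (f₂ (u₂ N w₂ k)) (f₁ (u₁ N w₁ k))) := by
      intro k
      rw [hin₂, blockInput_odd]
      simp only [Code.outputs_apply, Fin.val_last, heven₁, heven₂]
    constructor
    · refine (Equiv.symm_apply_eq _).mpr (funext fun k => ?_)
      simp only [Code.outputs_apply, heven₁, heven₂, hodd₁, hodd₂, hd₁]
      simp only [u₁, k.isLt, dif_pos]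
    · refine (Equiv.symm_apply_eq _).mpr (funext fun k => ?_)
      simp only [Code.outputs_apply, heven₁, heven₂, hodd₁, hodd₂, hd₂]
      simp only [u₂, k.isLt, dif_pos]
  refine ⟨by positivity, by positivity, _, _, c, ?_, ?_⟩
  · have hlarge : ∀ᶠ N : ℕ in atTop, 1 < (N : ℝ) * (1 - t) :=
      (tendsto_natCast_atTop_atTop.atTop_mul_const (sub_pos.mpr ht₁)).eventually_gt_atTop 1
    filter_upwards [hlarge] with N hN
    -- Rounding `N / 2` down loses at most half a block, which the factor `t < 1` absorbs for large
    -- `N`.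
    have hhalf : (N : ℝ) * t / 2 ≤ ((N / 2 : ℕ) : ℝ) := by
      have h : (N : ℝ) ≤ 2 * ((N / 2 : ℕ) : ℝ) + 1 := by
        exact_mod_cast (by omega : N ≤ 2 * (N / 2) + 1)
      linarith
    have key : ∀ s : ℕ, (2 : ℝ) ^ ((N : ℝ) * (t * (s / 2))) ≤ (((2 ^ s) ^ (N / 2) : ℕ) : ℝ) := by
      intro s
      rw [← pow_mul, Nat.cast_pow, Nat.cast_ofNat, ← Real.rpow_natCast]
      apply Real.rpow_le_rpow_of_exponent_le one_le_two
      push_cast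
      nlinarith [mul_le_mul_of_nonneg_left hhalf (Nat.cast_nonneg (α := ℝ) s)]
    simp only [Fintype.card_pi, Finset.prod_const, Finset.card_univ, Fintype.card_fin, hs₁, hs₂]
    exact ⟨key s₁, key s₂⟩
  · have hzero : ∀ N, (c N).errorProb = 0 := by
      intro N
      have : IsEmpty {w : Fin (Fintype.card (Fin (N / 2) → A₁)) ×
          Fin (Fintype.card (Fin (N / 2) → A₂)) // ¬ (c N).Correct w.1 w.2} :=
        ⟨fun w => w.2 (hcorrect N _ _)⟩
      simp [Code.errorProb]
    simp only [hzero]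
    exact tendsto_const_nhds

/-! ### The relaying scheme -/

/-- The signal whose `m` highest levels are those of `b` and whose other levels are `c`. -/
def merge (n m : ℕ) (b : Signal (max n m)) (c : Fin (max n m - m) → ZMod 2) :
    Signal (max n m) :=
  fun r => if h : (r : ℕ) < m then b r else c ⟨r - m, by omega⟩

/-- The input in the second slot: the levels of the other transmitter's first input that were
heard as interference at the own receiver, with output `y`, completed by fresh bits. -/
def relayInput (n m : ℕ) (a : Signal (max n m) × (Fin (max n m - m) → ZMod 2))
    (y : Signal (max n m)) : Signal (max n m) :=
  merge n m (fun r => if h : (r : ℕ) < m then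
    (y - (shiftMatrix (max n m) n).mulVec a.1) ⟨r + (max n m - m), by omega⟩ else 0) a.2

theorem relayInput_received (n m : ℕ) (a : Signal (max n m) × (Fin (max n m - m) → ZMod 2))
    (b : Signal (max n m)) : relayInput n m a (received n m a.1 b) = merge n m b a.2 := by
  funext r
  simp only [relayInput, merge, received, add_sub_cancel_left]
  split_ifs with h
  · simp [shiftMatrix_mulVec_apply]
  · rfl

/-- Level by level from the top: each output level is a wanted bit plus a bit `|n - m|` levels
higher. Alternating between the two slots recovers the bits of `a` and `b` in turn; `n ≠ m` makes
the recursion descend. -/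
theorem two_slot_injective {n m : ℕ} (hnm : n ≠ m) {a b a' b' : Signal (max n m)}
    {c d c' d' : Fin (max n m - m) → ZMod 2}
    (h₁ : received n m a b = received n m a' b')
    (h₂ : received n m (merge n m b c) (merge n m a d) =
      received n m (merge n m b' c') (merge n m a' d')) :
    a = a' ∧ c = c' := by
  have e₁ : ∀ r : Fin (max n m), _ := fun r => congrFun h₁ r
  have e₂ : ∀ r : Fin (max n m), _ := fun r => congrFun h₂ r
  simp only [received_apply] at e₁ e₂
  rcases lt_or_gt_of_ne hnm with hlt | hlt
  · have hz : max n m - m = 0 := by omega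
    simp only [hz, Nat.sub_zero, zero_le, if_true, Fin.eta] at e₁ e₂
    have hmerge : ∀ x y (r : Fin (max n m)), merge n m x y r = x r := fun x y r => by
      rw [merge, dif_pos (by omega)]
    simp only [hmerge] at e₂
    have hab : ∀ r : Fin (max n m), (∀ h : max n m - n ≤ (r : ℕ),
        a ⟨r - (max n m - n), by omega⟩ = a' ⟨r - (max n m - n), by omega⟩) → b r = b' r := by
      intro r hr
      have h := e₁ r
      split_ifs at h with h'
      · rwa [hr h', add_right_inj] at h
      · rwa [add_right_inj] at h
    have hba : ∀ r : Fin (max n m), (∀ h : max n m - n ≤ (r : ℕ),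
        b ⟨r - (max n m - n), by omega⟩ = b' ⟨r - (max n m - n), by omega⟩) → a r = a' r := by
      intro r hr
      have h := e₂ r
      split_ifs at h with h'
      · rwa [hr h', add_right_inj] at h
      · rwa [add_right_inj] at h
    -- Bit `k` of `a` follows from bit `k - (m - n)` of `b` (second slot), which follows from bit `k
    -- - 2 * (m - n)` of `a` (first slot).
    have key : ∀ k, ∀ hk : k < max n m, a ⟨k, hk⟩ = a' ⟨k, hk⟩ := by
      intro k
      induction k using Nat.strong_induction_on with
      | _ k ih =>
        intro hk
        refine hba ⟨k, hk⟩ fun (h : max n m - n ≤ k) => hab _ fun _ => ?_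
        exact ih (k - (max n m - n) - (max n m - n)) (by omega) (by omega)
    refine ⟨funext fun r => key r r.isLt, funext fun k => ?_⟩
    exact absurd k.isLt (by omega)
  · have hz : max n m - n = 0 := by omega
    simp only [hz, Nat.sub_zero, zero_le, if_true, Fin.eta] at e₁ e₂
    have hab : ∀ r : Fin (max n m), (∀ h : max n m - m ≤ (r : ℕ),
        b ⟨r - (max n m - m), by omega⟩ = b' ⟨r - (max n m - m), by omega⟩) → a r = a' r := by
      intro r hr
      have h := e₁ r
      split_ifs at h with h'
      · rwa [hr h', add_left_inj] at h
      · rwa [add_left_inj] at h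
    have hba : ∀ r : Fin (max n m), (∀ h : max n m - m ≤ (r : ℕ),
        a ⟨r - (max n m - m), by omega⟩ = a' ⟨r - (max n m - m), by omega⟩) →
        merge n m b c r = merge n m b' c' r := by
      intro r hr
      have h := e₂ r
      split_ifs at h with h'
      -- The fresh bits `d` lie below the `m` levels that the cross link carries, so only bits of
      -- `a` interfere.
      · have hlow : (r : ℕ) - (max n m - m) < m := by omega
        have ha : merge n m a d ⟨r - (max n m - m), by omega⟩ =
            merge n m a' d' ⟨r - (max n m - m), by omega⟩ := by
          simpa only [merge, hlow, dif_pos] using hr h'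
        rwa [ha, add_left_inj] at h
      · rwa [add_left_inj] at h
    have key : ∀ k, ∀ hk : k < m, b ⟨k, by omega⟩ = b' ⟨k, by omega⟩ := by
      intro k
      induction k using Nat.strong_induction_on with
      | _ k ih =>
        intro hk
        have h := hba ⟨k, by omega⟩ fun (h : max n m - m ≤ k) => hab _ fun _ =>
          ih (k - (max n m - m) - (max n m - m)) (by omega) (by omega)
        simpa only [merge, hk, dif_pos] using h
    have ha : ∀ r, a r = a' r := fun r => hab r fun h => key _ (by omega)
    refine ⟨funext ha, funext fun k => ?_⟩
    have h := hba ⟨m + k, by omega⟩ fun _ => ha _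
    simpa [merge] using h

theorem exists_achievable_scaled (n m : ℕ) : ∃ s₁ s₂ : ℕ,
    s₁ + s₂ = 2 * (max n m + (max n m - m)) ∧
    ∀ t : ℝ, 0 ≤ t → t < 1 → Achievable n m (t * (s₁ / 2), t * (s₂ / 2)) := by
  by_cases hnm : n = m
  · subst hnm
    -- Both receivers see the same sum, so transmitter 2 stays silent and transmitter 1 sends `2 *
    -- q` uncoded bits in two slots.
    refine ⟨max n n + max n n, 0, by simp; ring, fun t ht₀ ht₁ => ?_⟩
    have hrec : ∀ x : Signal (max n n), received n n x 0 = x := by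
      intro x
      funext r
      simp [received_apply]
    refine achievable_of_two_slot_scheme
      (A₁ := Signal (max n n) × Signal (max n n)) (A₂ := Unit)
      (fun a => a.1) (fun _ => 0) (fun a _ _ => a.2) (fun _ _ _ => 0)
      (fun y y' => (y, y')) (fun _ _ => ()) ?_ ?_ ?_ ?_ ht₀ ht₁
    · intro a b
      simp only [hrec]
    · intro a b
      rfl
    · simp [pow_add]
    · simp
  · refine ⟨max n m + (max n m - m), max n m + (max n m - m), by ring, fun t ht₀ ht₁ => ?_⟩
    let A : Type := Signal (max n m) × (Fin (max n m - m) → ZMod 2)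
    let Y : A × A → Signal (max n m) × Signal (max n m) := fun p =>
      (received n m p.1.1 p.2.1,
        received n m (merge n m p.2.1 p.1.2) (merge n m p.1.1 p.2.2))
    have hY : Function.FactorsThrough (Prod.fst : A × A → A) Y := by
      rintro ⟨⟨a, c⟩, ⟨b, d⟩⟩ ⟨⟨a', c'⟩, ⟨b', d'⟩⟩ h
      obtain ⟨h₁, h₂⟩ := Prod.mk.inj h
      obtain ⟨rfl, rfl⟩ := two_slot_injective hnm h₁ h₂
      rfl
    -- The decoder inverts `Y` up to the own message; its value off the range of `Y` is irrelevant.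
    let D : Signal (max n m) → Signal (max n m) → A := fun y y' =>
      Function.extend Y Prod.fst (fun _ => (0, 0)) (y, y')
    have hD : ∀ p : A × A, D (Y p).1 (Y p).2 = p.1 := fun p => hY.extend_apply _ p
    have hcard : Fintype.card A = 2 ^ (max n m + (max n m - m)) := by
      simp [A, pow_add]
    have : Inhabited A := ⟨(0, 0)⟩
    refine achievable_of_two_slot_scheme (A₁ := A) (A₂ := A) Prod.fst Prod.fst
      (fun a y _ => relayInput n m a y) (fun a _ y => relayInput n m a y) D D
      ?_ ?_ hcard hcard ht₀ ht₁
    · intro a b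
      simp only [relayInput_received]
      exact hD (a, b)
    · intro a b
      simp only [relayInput_received]
      exact hD (b, a)

end FeedbackIC

theorem theorem3 (n m : ℕ) :
    FeedbackIC.IsSumCapacity n m (max (n : ℝ) (m : ℝ) + max ((n : ℝ) - (m : ℝ)) 0) := by
  have hC : max (n : ℝ) (m : ℝ) + max ((n : ℝ) - (m : ℝ)) 0 =
      ((max n m + (max n m - m) : ℕ) : ℝ) := by
    rcases le_total n m with h | h
    · have h' : (n : ℝ) ≤ m := by exact_mod_cast h
      simp [h, h']
    · have h' : (m : ℝ) ≤ n := by exact_mod_cast h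
      simp [h, h', Nat.cast_sub h]
  rw [hC]
  constructor
  · rintro _ ⟨R, hR, rfl⟩
    have hclosed : IsClosed {R : ℝ × ℝ | R.1 + R.2 ≤ ((max n m + (max n m - m) : ℕ) : ℝ)} :=
      isClosed_le (by fun_prop) continuous_const
    exact closure_minimal (fun R hR => FeedbackIC.Achievable.add_le hR) hclosed hR
  · intro u hu
    obtain ⟨s₁, s₂, hs, hach⟩ := FeedbackIC.exists_achievable_scaled n m
    have hs' : (s₁ : ℝ) / 2 + s₂ / 2 = ((max n m + (max n m - m) : ℕ) : ℝ) := by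
      have : (s₁ : ℝ) + s₂ = 2 * ((max n m + (max n m - m) : ℕ) : ℝ) := by exact_mod_cast hs
      linarith
    rw [← hs']
    -- Only rates scaled by `t < 1` are known to be achievable; the limit `t → 1` gives the full
    -- sum.
    have hle : ∀ t ∈ Set.Ico (0 : ℝ) 1, t * ((s₁ : ℝ) / 2 + s₂ / 2) ≤ u := by
      intro t ht
      rw [mul_add]
      exact hu ⟨_, subset_closure (hach t ht.1 ht.2), rfl⟩
    have hlim : Filter.Tendsto (fun t : ℝ => t * ((s₁ : ℝ) / 2 + s₂ / 2))
        (nhdsWithin 1 (Set.Iio 1)) (nhds (1 * ((s₁ : ℝ) / 2 + s₂ / 2))) :=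
      ((continuous_id.mul continuous_const).tendsto 1).mono_left nhdsWithin_le_nhds
    rw [one_mul] at hlim
    exact le_of_tendsto hlim
      (Filter.eventually_of_mem (Ico_mem_nhdsLT (by norm_num)) hle)
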